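/- Let $n$ be a natural number and let $K$ be a field with $\operatorname{char} K=0$ or $\operatorname{char} K>n$. Let $V_1,\dots,V_t$ be a complete set of representatives of the isomorphism classes of simple modules over the group algebra $KS_n$, and write $mV_i$ for the direct sum of $m$ copies of $V_i$. A $KS_n$-module is called $r$-generated (for an integer $r\ge 0$) if it is generated as a $KS_n$-module by $r$ (not necessarily distinct) elements. (1) Let $V$ be a finitely generated $KS_n$-module with canonical decomposition $V\cong\bigoplus_{i=1}^t n_iV_i$. Then $V$ is $r$-generated if and only if $n_i\le r\cdot\dim_K V_i$ for every $i$. In particular, the smallest $r$ such that $V$ is $r$-generated is $$r=\left\lceil\max\left\{\frac{n_i}{\dim_K V_i}\;\middle|\;1\le i\le t\right\}\right\rceil .$$ (2) Let $S_n$ act on $R=K[x_1,\dots,x_n]$ by $\sigma\cdot f(x_1,\dots,x_n)=f(x_{\sigma(1)},\dots,x_{\sigma(n)})$. For $f_1,\dots,f_r\in R$ let $(f_1,\dots,f_r)_{S_n}$ be the ideal generated by all $\sigma\cdot f_j$ with $\sigma\in S_n$ and $1\le j\le r$. An ideal of $R$ closed under the action is called symmetric. A symmetric ideal $I$ is called $r$-generated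 if $I=(f_1,\dots,f_r)_{S_n}$ for some homogeneous $f_1,\dots,f_r$ of the same degree, and principal symmetric if it is $1$-generated. Let $I$ be a symmetric ideal that is generated by homogeneous polynomials of a single degree $d$, let $I_d$ be its degree $d$ part, and let $I_d\cong\bigoplus_{i=1}^t n_iV_i$ be the canonical decomposition of the $KS_n$-module $I_d$. Then $I$ is $r$-generated if and only if $n_i\le r\cdot\dim_K V_i$ for every $i$; the smallest $r$ such that $I$ is $r$-generated is $\left\lceil\max_i n_i/\dim_K V_i\right\rceil$; and $I$ is a principal symmetric ideal if and only if $n_i\le\dim_K V_i$ for every $i$. -/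

import Mathlib

universe u v w

open scoped MonoidAlgebra

/-- An `A`-module `M` is `r`-generated if it is the span of `r` (not necessarily distinct)
elements. -/
def IsRGeneratedModule (A : Type*) [Ring A] (r : ℕ) (M : Type*) [AddCommGroup M] [Module A M] :
    Prop :=
  ∃ f : Fin r → M, Submodule.span A (Set.range f) = ⊤

/-- `S 0, …, S (t-1)` is a complete set of representatives of the isomorphism classes of simple
`A`-modules. Every simple `A`-module is a quotient of `A`, so it is enough (and equivalent) to
test completeness on simple modules in the universe of `A`. -/
structure IsCompleteSetOfSimples (A : Type u) [Ring A] {t : ℕ} (S : Fin t → Type v)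
    [∀ i, AddCommGroup (S i)] [∀ i, Module A (S i)] : Prop where
  simple : ∀ i, IsSimpleModule A (S i)
  pairwise_not_iso : ∀ i j, Nonempty (S i ≃ₗ[A] S j) → i = j
  complete : ∀ (M : Type u) [AddCommGroup M] [Module A M], IsSimpleModule A M →
    ∃ i, Nonempty (M ≃ₗ[A] S i)

/-- `M ≅ ⨁ᵢ mᵢ Sᵢ`, where `mᵢ Sᵢ` is the direct sum of `mᵢ` copies of `Sᵢ` (all the direct sums
are finite, so they are written as products). -/
def HasDecomposition (A : Type*) [Ring A] {t : ℕ} (S : Fin t → Type*)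
    [∀ i, AddCommGroup (S i)] [∀ i, Module A (S i)] (m : Fin t → ℕ)
    (M : Type*) [AddCommGroup M] [Module A M] : Prop :=
  Nonempty (M ≃ₗ[A] ((i : Fin t) → Fin (m i) → S i))

/-- The action of the symmetric group on `K[x₁, …, xₙ]`:
`σ • f (x₁, …, xₙ) = f (x_{σ 1}, …, x_{σ n})`. -/
noncomputable def permRep (K : Type*) [Field K] (n : ℕ) :
    Representation K (Equiv.Perm (Fin n)) (MvPolynomial (Fin n) K) where
  toFun σ := (MvPolynomial.rename σ).toLinearMap
  map_one' := by
    refine LinearMap.ext fun f => ?_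
    exact MvPolynomial.rename_id_apply f
  map_mul' σ τ := by
    refine LinearMap.ext fun f => ?_
    exact (MvPolynomial.rename_rename τ σ f).symm

/-- An ideal is symmetric if it is closed under the action of the symmetric group. -/
def IsSymmetricIdeal {K : Type*} [Field K] {n : ℕ} (I : Ideal (MvPolynomial (Fin n) K)) : Prop :=
  ∀ σ : Equiv.Perm (Fin n), ∀ f ∈ I, permRep K n σ f ∈ I

/-- The symmetric ideal `(f₁, …, f_r)_{Sₙ} = (σ • f_j : σ ∈ Sₙ, 1 ≤ j ≤ r)`. -/
noncomputable def symmetricIdealSpan {K : Type*} [Field K] {n r : ℕ}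
    (f : Fin r → MvPolynomial (Fin n) K) : Ideal (MvPolynomial (Fin n) K) :=
  Ideal.span {g | ∃ (σ : Equiv.Perm (Fin n)) (j : Fin r), g = permRep K n σ (f j)}

/-- `I = (f₁, …, f_r)_{Sₙ}` for some homogeneous `f₁, …, f_r` of the same degree. -/
def IsRGeneratedSymmetricIdeal {K : Type*} [Field K] {n : ℕ} (r : ℕ)
    (I : Ideal (MvPolynomial (Fin n) K)) : Prop :=
  ∃ (e : ℕ) (f : Fin r → MvPolynomial (Fin n) K),
    (∀ j, (f j).IsHomogeneous e) ∧ I = symmetricIdealSpan f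

/-- A principal symmetric ideal: a symmetric ideal `(f)_{Sₙ}` with `f` homogeneous. -/
def IsPrincipalSymmetricIdeal {K : Type*} [Field K] {n : ℕ}
    (I : Ideal (MvPolynomial (Fin n) K)) : Prop :=
  IsRGeneratedSymmetricIdeal 1 I

/-- `I` is generated by homogeneous polynomials of the single degree `d`. -/
def IsGeneratedInDegree {K : Type*} [Field K] {n : ℕ} (d : ℕ)
    (I : Ideal (MvPolynomial (Fin n) K)) : Prop :=
  I = Ideal.span {f | f ∈ I ∧ f.IsHomogeneous d}

/-- The degree `d` part `I_d` of a symmetric ideal `I`, as a subrepresentation of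
`K[x₁, …, xₙ]`. -/
noncomputable def idealDegreePart {K : Type*} [Field K] {n : ℕ}
    (I : Ideal (MvPolynomial (Fin n) K)) (hI : IsSymmetricIdeal I) (d : ℕ) :
    Subrepresentation (permRep K n) where
  toSubmodule := I.restrictScalars K ⊓ MvPolynomial.homogeneousSubmodule (Fin n) K d
  apply_mem_toSubmodule σ f hf :=
    ⟨hI σ f hf.1, MvPolynomial.IsHomogeneous.rename_isHomogeneous hf.2⟩

/-!
The field `K` is a splitting field for the symmetric group. Given a simple module, choose among the
words `x` for which the stabilizer of `x` has a nonzero invariant vector one with least letter sum.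
Carry such a vector equivariantly along the orbit of `x`. For another word `y` of the orbit, the sum
of the vectors over the orbit of `y` under the stabilizer of `x ⊓ y` is invariant under that
stabilizer, hence zero by minimality. Averaging this relation over the stabilizer of `x` expresses
the contribution of `y` through words closer to `x`, so the invariants of the stabilizer of `x` form
a line, which every endomorphism preserves: endomorphisms of simple modules are scalars.

Consequently `f₁, …, f_r` generate `∏ᵢ Sᵢ^{mᵢ}` iff, for each `i`, their `mᵢ` coordinate vectors in
`Sᵢ^r` are linearly independent over `K`: a proper submodule lies in the kernel of a nonzero map to
some `Sᵢ`, and such a map is a `K`-linear combination of coordinates. Such families exist iff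
`mᵢ ≤ r · dim Sᵢ`. Finally, homogeneous polynomials of degree `d` generate an ideal that is
generated in degree `d` iff they span its degree `d` part over `K`.
-/

section RearrangedWords

theorem exists_perm_comp_eq_fixing_agreements {α β : Type*} [Finite α] (f : α → β)
    (k : Equiv.Perm α) :
    ∃ h : Equiv.Perm α, f ∘ k ∘ h = f ∧ ∀ p, f (k p) = f p → h p = p := by
  classical
  have := Fintype.ofFinite α
  have fiberwise (b : β) : ∃ e : {p // f p = b} ≃ {p // f (k p) = b},
      ∀ p : {p // f p = b}, f (k p) = b → (e p : α) = p := by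
    have card_eq :
        Fintype.card {p // f p = b} = (Finset.univ.filter fun p => f (k p) = b).card := by
      rw [← Fintype.card_subtype]
      exact Fintype.card_congr (k.subtypeEquiv fun p => Iff.rfl).symm
    obtain ⟨e, he⟩ := Set.MapsTo.exists_equiv_extend_of_card_eq card_eq
      (s := {p | f (k p) = b}) (f := Subtype.val) (fun p hp => by simpa using hp)
      Subtype.val_injective.injOn
    exact ⟨e.trans (Equiv.subtypeEquivRight (by simp)), fun p hp => he p hp⟩
  choose e he using fiberwise
  exact ⟨Equiv.ofFiberEquiv e, funext fun p => Equiv.ofFiberEquiv_map e p,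
    fun p hp => he (f p) ⟨p, rfl⟩ hp⟩

attribute [local instance] arrowAction

open MulAction

variable {α β : Type*} [LinearOrder β]

theorem smul_inf_word (σ : Equiv.Perm α) (x y : α → β) : σ • (x ⊓ y) = σ • x ⊓ σ • y := rfl

theorem inf_le_of_mem_orbit_stabilizer_inf {x y z : α → β}
    (hz : z ∈ orbit (stabilizer (Equiv.Perm α) (x ⊓ y)) y) : x ⊓ y ≤ z := by
  obtain ⟨⟨σ, hσ⟩, rfl⟩ := hz
  calc x ⊓ y = σ • x ⊓ σ • y := hσ.symm
    _ ≤ σ • y := inf_le_right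

theorem exists_mem_stabilizer_smul_eq [Finite α] {x y : α → β} {σ : Equiv.Perm α}
    (hσ : σ ∈ stabilizer (Equiv.Perm α) (x ⊓ y)) (hxy : x ⊓ σ • y = x ⊓ y) :
    ∃ τ ∈ stabilizer (Equiv.Perm α) x, τ • y = σ • y := by
  obtain ⟨h, hfh, hfix⟩ := exists_perm_comp_eq_fixing_agreements
    (fun p => ((x ⊓ y) p, y p)) σ⁻¹
  have inf_smul (p : α) : (x ⊓ y) (σ⁻¹ p) = (x ⊓ y) p := congrFun hσ p
  have inf_h (p : α) : (x ⊓ y) (h p) = (x ⊓ y) p :=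
    (inf_smul (h p)).symm.trans (congrArg Prod.fst (congrFun hfh p))
  have smul_h (p : α) : (σ • y) (h p) = y p := congrArg Prod.snd (congrFun hfh p)
  have fix_of_eq {p : α} (hp : (σ • y) p = y p) : h p = p :=
    hfix p (Prod.ext (inf_smul p) hp)
  have eq_inf_of_ne {p : α} (hp : (σ • y) p ≠ y p) : x p = (x ⊓ y) p := by
    have := congrFun hxy p
    simp only [Pi.inf_apply] at this ⊢
    grind
  have x_h (p : α) : x (h p) = x p := by
    by_cases hp : (σ • y) p = y p
    · rw [fix_of_eq hp]
    · have hhp : (σ • y) (h p) ≠ y (h p) := fun hh => hp <| by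
        rwa [h.injective (fix_of_eq hh)] at hh
      rw [eq_inf_of_ne hp, eq_inf_of_ne hhp, inf_h]
  refine ⟨h, ?_, ?_⟩
  · exact funext fun p => (x_h (h⁻¹ p)).symm.trans (congrArg x (h.apply_symm_apply p))
  · exact funext fun p =>
      (smul_h (h⁻¹ p)).symm.trans (congrArg (σ • y) (h.apply_symm_apply p))

theorem mem_orbit_stabilizer_inf_and_inf_eq_iff [Finite α] {x y z : α → β} :
    (z ∈ orbit (stabilizer (Equiv.Perm α) (x ⊓ y)) y ∧ x ⊓ z = x ⊓ y) ↔
      z ∈ orbit (stabilizer (Equiv.Perm α) x ⊓ stabilizer (Equiv.Perm α) (x ⊓ y) :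
        Subgroup (Equiv.Perm α)) y := by
  constructor
  · rintro ⟨⟨⟨σ, hσ⟩, rfl⟩, hxy⟩
    obtain ⟨τ, hτx, hτy⟩ := exists_mem_stabilizer_smul_eq hσ hxy
    have hτ : τ • (x ⊓ y) = x ⊓ y := by
      rw [smul_inf_word, mem_stabilizer_iff.1 hτx, hτy]
      exact hxy
    exact ⟨⟨τ, hτx, hτ⟩, hτy⟩
  · rintro ⟨⟨τ, hτx, hτ⟩, rfl⟩
    refine ⟨⟨⟨τ, hτ⟩, rfl⟩, ?_⟩
    calc x ⊓ τ • y = τ • x ⊓ τ • y := by rw [mem_stabilizer_iff.1 hτx]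
      _ = x ⊓ y := hτ

end RearrangedWords

section StabilizerInvariants

open MulAction

variable {K G M X : Type*} [Group G] [MulAction G X]

/-- The restriction of a representation `ρ` to the stabilizer of `x`. -/
abbrev stabilizerRep [CommSemiring K] [AddCommMonoid M] [Module K M] (ρ : Representation K G M)
    (x : X) : Representation K (stabilizer G x) M :=
  ρ.comp (stabilizer G x).subtype

theorem exists_equivariant_of_mem_invariants [CommRing K] [AddCommGroup M] [Module K M]
    {ρ : Representation K G M} {x : X} {v : M} (hv : v ∈ (stabilizerRep ρ x).invariants) :
    ∃ w : X → M, (∀ (g : G) (y : X), w (g • y) = ρ g (w y)) ∧ w x = v := by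
  have factors : Function.FactorsThrough (fun g : G => ρ g v) (fun g : G => g • x) := by
    intro g h hgh
    have fixes : g⁻¹ * h ∈ stabilizer G x := by
      rw [mem_stabilizer_iff, mul_smul, ← show g • x = h • x from hgh, inv_smul_smul]
    calc ρ g v = ρ g (ρ (g⁻¹ * h) v) := by rw [show ρ (g⁻¹ * h) v = v from hv ⟨_, fixes⟩]
      _ = ρ h v := by rw [← Module.End.mul_apply, ← map_mul, mul_inv_cancel_left]
  refine ⟨Function.extend (fun g : G => g • x) (fun g : G => ρ g v) 0, fun g y => ?_, ?_⟩
  · by_cases hy : ∃ h : G, h • x = y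
    · obtain ⟨h, rfl⟩ := hy
      rw [smul_smul, factors.extend_apply, factors.extend_apply, map_mul, Module.End.mul_apply]
    · have hgy : ¬ ∃ h : G, h • x = g • y := fun ⟨h, hh⟩ =>
        hy ⟨g⁻¹ * h, by rw [mul_smul, hh, inv_smul_smul]⟩
      rw [Function.extend_apply' _ _ _ hgy, Function.extend_apply' _ _ _ hy, Pi.zero_apply,
        Pi.zero_apply, map_zero]
  · simpa using factors.extend_apply 0 1

theorem norm_apply_of_mem_invariants [CommRing K] [AddCommGroup M] [Module K M] [Fintype G]
    {ρ : Representation K G M} {v : M} (hv : v ∈ ρ.invariants) :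
    ρ.norm v = (Nat.card G : K) • v := by
  simp only [Representation.norm, LinearMap.sum_apply, (ρ.mem_invariants v).1 hv,
    Finset.sum_const, Finset.card_univ, Nat.card_eq_fintype_card, Nat.cast_smul_eq_nsmul]

theorem norm_stabilizer_apply_smul [CommRing K] [AddCommGroup M] [Module K M]
    {ρ : Representation K G M} {w : X → M} (hw : ∀ (g : G) (y : X), w (g • y) = ρ g (w y))
    {x : X} [Fintype (stabilizer G x)] {τ : G} (hτ : τ ∈ stabilizer G x) (y : X) :
    (stabilizerRep ρ x).norm (w (τ • y)) = (stabilizerRep ρ x).norm (w y) := by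
  rw [hw]
  exact (stabilizerRep ρ x).norm_self_apply ⟨τ, hτ⟩ (w y)

theorem sum_orbit_mem_invariants [CommRing K] [AddCommGroup M] [Module K M]
    {ρ : Representation K G M} {w : X → M} (hw : ∀ (g : G) (y : X), w (g • y) = ρ g (w y))
    (y : X) [Fintype (orbit G y)] : ∑ z : orbit G y, w z ∈ ρ.invariants := by
  intro g
  rw [map_sum]
  exact Fintype.sum_equiv (toPerm g) _ _ fun z => (hw g z).symm

theorem natCast_card_subgroup_ne_zero [Semiring K] (hG : (Nat.card G : K) ≠ 0) (H : Subgroup G) :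
    (Nat.card H : K) ≠ 0 :=
  ne_zero_of_dvd_ne_zero hG (Nat.cast_dvd_cast H.card_subgroup_dvd_card)

theorem natCast_card_orbit_ne_zero [Semiring K] (hG : (Nat.card G : K) ≠ 0) (y : X) :
    (Nat.card (orbit G y) : K) ≠ 0 := by
  rw [Nat.card_congr (orbitEquivQuotientStabilizer G y)]
  exact ne_zero_of_dvd_ne_zero hG (Nat.cast_dvd_cast (Subgroup.card_quotient_dvd_card _))

end StabilizerInvariants

section YoungSubgroups

attribute [local instance] arrowAction Fintype.ofFinite

open MulAction

variable {K α M : Type*} [Field K] [Finite α] [AddCommGroup M] [Module K M]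
  {ρ : Representation K (Equiv.Perm α) M}

theorem norm_stabilizer_mem_of_lt_inf {β : Type*} [LinearOrder β]
    (hcard : (Nat.card (Equiv.Perm α) : K) ≠ 0) {w : (α → β) → M}
    (hw : ∀ (g : Equiv.Perm α) y, w (g • y) = ρ g (w y)) {x y : α → β}
    (hinf : (stabilizerRep ρ (x ⊓ y)).invariants = ⊥) {N : Submodule K M}
    (hN : ∀ z ∈ orbit (stabilizer (Equiv.Perm α) (x ⊓ y)) y, x ⊓ y < x ⊓ z →
      (stabilizerRep ρ x).norm (w z) ∈ N) :
    (stabilizerRep ρ x).norm (w y) ∈ N := by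
  let P : Subgroup (Equiv.Perm α) := stabilizer _ x ⊓ stabilizer _ (x ⊓ y)
  have finite_orbit (H : Subgroup (Equiv.Perm α)) : Finite (orbit H y) :=
    Set.finite_range fun h : H => h • y
  let orb := (orbit (stabilizer (Equiv.Perm α) (x ⊓ y)) y).toFinset
  have sum_zero : ∑ z ∈ orb, w z = 0 := by
    have := sum_orbit_mem_invariants (ρ := stabilizerRep ρ (x ⊓ y)) (w := w) (fun g => hw g) y
    rw [hinf, Submodule.mem_bot] at this
    rw [← this]
    exact Finset.sum_subtype _ (by simp [orb]) _
  have norm_orbit (z) (hz : z ∈ orbit P y) :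
      (stabilizerRep ρ x).norm (w z) = (stabilizerRep ρ x).norm (w y) := by
    obtain ⟨τ, rfl⟩ := hz
    exact norm_stabilizer_apply_smul hw τ.2.1 y
  have split : (Nat.card (orbit P y) : K) • (stabilizerRep ρ x).norm (w y) +
      ∑ z ∈ orb with ¬ x ⊓ z = x ⊓ y, (stabilizerRep ρ x).norm (w z) = 0 := by
    have filter_eq : orb.filter (fun z => x ⊓ z = x ⊓ y) = (orbit P y).toFinset := by
      ext z
      simpa [orb] using mem_orbit_stabilizer_inf_and_inf_eq_iff
    calc _ = ∑ z ∈ orb with x ⊓ z = x ⊓ y, (stabilizerRep ρ x).norm (w z) + _ := by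
          rw [filter_eq, Finset.sum_congr rfl fun z hz => norm_orbit z (Set.mem_toFinset.1 hz),
            Finset.sum_const, Nat.cast_smul_eq_nsmul, Nat.card_eq_card_toFinset]
      _ = (stabilizerRep ρ x).norm (∑ z ∈ orb, w z) := by
          rw [Finset.sum_filter_add_sum_filter_not, map_sum]
      _ = 0 := by rw [sum_zero, map_zero]
  have card_ne_zero : (Nat.card (orbit P y) : K) ≠ 0 :=
    natCast_card_orbit_ne_zero (natCast_card_subgroup_ne_zero hcard P) y
  refine (Submodule.smul_mem_iff N card_ne_zero).1 ?_
  rw [eq_neg_of_add_eq_zero_left split]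
  refine neg_mem (Submodule.sum_mem _ fun z hz => ?_)
  obtain ⟨hz, hne⟩ := Finset.mem_filter.1 hz
  rw [Set.mem_toFinset] at hz
  exact hN z hz <| lt_of_le_of_ne
    (le_inf inf_le_left (inf_le_of_mem_orbit_stabilizer_inf hz)) (Ne.symm hne)

theorem sum_inf_lt_of_ne {x y : α → ℕ} (hxy : ∑ p, y p = ∑ p, x p) (hne : y ≠ x) :
    ∑ p, (x ⊓ y) p < ∑ p, x p := by
  refine lt_of_le_of_ne (Finset.sum_le_sum fun p _ => inf_le_left) fun h => hne ?_
  have inf_eq_left := (Finset.sum_eq_sum_iff_of_le fun p _ => (inf_le_left : (x ⊓ y) p ≤ x p)).1 h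
  have inf_eq_right := (Finset.sum_eq_sum_iff_of_le fun p _ => (inf_le_right : (x ⊓ y) p ≤ y p)).1
    (h.trans hxy.symm)
  exact funext fun p =>
    (inf_eq_right p (Finset.mem_univ p)).symm.trans (inf_eq_left p (Finset.mem_univ p))

theorem norm_stabilizer_mem_span_of_minimal (hcard : (Nat.card (Equiv.Perm α) : K) ≠ 0)
    {w : (α → ℕ) → M} (hw : ∀ (g : Equiv.Perm α) y, w (g • y) = ρ g (w y)) {x : α → ℕ}
    (hmin : ∀ u : α → ℕ, ∑ p, u p < ∑ p, x p → (stabilizerRep ρ u).invariants = ⊥)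
    (y : α → ℕ) (hy : ∑ p, y p = ∑ p, x p) :
    (stabilizerRep ρ x).norm (w y) ∈ Submodule.span K {w x} := by
  induction hd : ∑ p, x p - ∑ p, (x ⊓ y) p using Nat.strong_induction_on generalizing y with
  | _ d ih =>
  obtain rfl | hne := eq_or_ne y x
  · have w_mem : w y ∈ (stabilizerRep ρ y).invariants := fun g =>
      (hw g y).symm.trans (congrArg w g.2)
    rw [norm_apply_of_mem_invariants w_mem]
    exact Submodule.smul_mem _ _ (Submodule.mem_span_singleton_self _)
  · have inf_lt := sum_inf_lt_of_ne hy hne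
    refine norm_stabilizer_mem_of_lt_inf hcard hw (hmin _ inf_lt) fun z hz hlt => ?_
    have sum_lt : ∑ p, (x ⊓ y) p < ∑ p, (x ⊓ z) p := Fintype.sum_strictMono hlt
    refine ih _ (by omega) z ?_ rfl
    obtain ⟨σ, rfl⟩ := hz
    exact (Equiv.sum_comp (σ : Equiv.Perm α)⁻¹ y).trans hy

theorem exists_word_invariants_minimal [Nontrivial M] (ρ : Representation K (Equiv.Perm α) M) :
    ∃ x : α → ℕ, (stabilizerRep ρ x).invariants ≠ ⊥ ∧
      ∀ u : α → ℕ, ∑ p, u p < ∑ p, x p → (stabilizerRep ρ u).invariants = ⊥ := by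
  obtain ⟨n, ⟨e⟩⟩ := Finite.exists_equiv_fin α
  let x : α → ℕ := fun p => e p
  have invariants_eq_top : (stabilizerRep ρ x).invariants = ⊤ := by
    refine Submodule.eq_top_iff'.2 fun v σ => ?_
    have fixes (p : α) : (σ : Equiv.Perm α)⁻¹ p = p :=
      e.injective (Fin.ext (congrFun σ.2 p))
    rw [show σ = 1 from Subtype.ext (inv_eq_one.1 (Equiv.ext fixes)), map_one, Module.End.one_apply]
  obtain ⟨x, hx, hmin⟩ := WellFounded.has_min
    (InvImage.wf (fun x : α → ℕ => ∑ p, x p) wellFounded_lt)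
    {x : α → ℕ | (stabilizerRep ρ x).invariants ≠ ⊥}
    ⟨x, by rw [Set.mem_ofPred_eq, invariants_eq_top]; exact top_ne_bot⟩
  exact ⟨x, hx, fun u hu => of_not_not fun h => hmin u h hu⟩

theorem exists_subgroup_invariants_eq_span_singleton [Nontrivial M]
    (hcard : (Nat.card (Equiv.Perm α) : K) ≠ 0)
    (hρ : ∀ v : M, v ≠ 0 → Submodule.span K (Set.range fun g => ρ g v) = ⊤) :
    ∃ (H : Subgroup (Equiv.Perm α)) (v : M), v ≠ 0 ∧
      Representation.invariants (ρ.comp H.subtype) = Submodule.span K {v} := by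
  obtain ⟨x, hx, hmin⟩ := exists_word_invariants_minimal ρ
  obtain ⟨_, hv, hv0⟩ := Submodule.exists_mem_ne_zero_of_ne_bot hx
  obtain ⟨w, hw, rfl⟩ := exists_equivariant_of_mem_invariants hv
  refine ⟨stabilizer _ x, w x, hv0, le_antisymm (fun u hu => ?_) ?_⟩
  · have norm_mem : ⊤ ≤ (Submodule.span K {w x}).comap (stabilizerRep ρ x).norm := by
      rw [← hρ _ hv0, Submodule.span_le]
      rintro _ ⟨g, rfl⟩
      change (stabilizerRep ρ x).norm (ρ g (w x)) ∈ Submodule.span K {w x}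
      rw [← hw]
      exact norm_stabilizer_mem_span_of_minimal hcard hw hmin _ (Equiv.sum_comp g⁻¹ x)
    have card_ne_zero := natCast_card_subgroup_ne_zero hcard (stabilizer (Equiv.Perm α) x)
    rw [← Submodule.smul_mem_iff _ card_ne_zero, ← norm_apply_of_mem_invariants hu]
    exact norm_mem Submodule.mem_top
  · rwa [Submodule.span_singleton_le_iff_mem]

end YoungSubgroups

section SpanOverGroupAlgebra

variable {K G : Type*} [CommSemiring K] [Monoid G]

theorem span_range_of_eq_top : Submodule.span K (Set.range (MonoidAlgebra.of K G)) = ⊤ := by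
  refine Submodule.eq_top_iff'.2 fun a => ?_
  induction a using MonoidAlgebra.induction_linear with
  | zero => exact Submodule.zero_mem _
  | add a b ha hb => exact Submodule.add_mem _ ha hb
  | single g c =>
    rw [← mul_one c, ← smul_eq_mul, ← MonoidAlgebra.smul_single]
    exact Submodule.smul_mem _ _ (Submodule.subset_span ⟨g, rfl⟩)

theorem span_range_of_smul {M ι : Type*} [AddCommMonoid M] [Module K M] [Module K[G] M]
    [IsScalarTower K K[G] M] (f : ι → M) :
    Submodule.span K {z | ∃ (g : G) (j : ι), z = MonoidAlgebra.of K G g • f j} =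
      (Submodule.span K[G] (Set.range f)).restrictScalars K := by
  open scoped Pointwise in
  rw [← Submodule.span_smul_of_span_eq_top span_range_of_eq_top (Set.range f)]
  congr 1
  ext z
  simp [Set.mem_smul, eq_comm]

end SpanOverGroupAlgebra

section ScalarEndomorphisms

theorem natCast_factorial_ne_zero_of_ringChar {K : Type*} [Ring K] [IsDomain K] {n : ℕ}
    (hK : ringChar K = 0 ∨ n < ringChar K) : (n.factorial : K) ≠ 0 := by
  rw [Ne, ringChar.spec]
  rcases hK with hK | hK
  · rw [hK, zero_dvd_iff]
    exact n.factorial_ne_zero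
  · have hp : (ringChar K).Prime :=
      (CharP.char_is_prime_or_zero K (ringChar K)).resolve_right (by omega)
    rwa [hp.dvd_factorial, not_le]

variable {K α S : Type*} [Field K] [Finite α] [AddCommGroup S] [Module K S]
  [Module K[Equiv.Perm α] S] [IsScalarTower K K[Equiv.Perm α] S]

theorem surjective_algebraMap_end_of_isSimpleModule_perm
    (hcard : (Nat.card (Equiv.Perm α) : K) ≠ 0) [IsSimpleModule K[Equiv.Perm α] S] :
    Function.Surjective (algebraMap K (Module.End K[Equiv.Perm α] S)) := by
  intro f
  have := IsSimpleModule.nontrivial K[Equiv.Perm α] S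
  let ρ : Representation K (Equiv.Perm α) S := Representation.ofModule' S
  have span_orbit (v : S) (hv : v ≠ 0) : Submodule.span K (Set.range fun g => ρ g v) = ⊤ := by
    have := span_range_of_smul (K := K) (G := Equiv.Perm α) fun _ : Unit => v
    rw [Set.range_const, IsSimpleModule.span_singleton_eq_top _ hv,
      Submodule.restrictScalars_top] at this
    rw [← this]
    congr 1
    ext z
    simp [ρ, Representation.ofModule', eq_comm]
  obtain ⟨H, v, hv0, hv⟩ := exists_subgroup_invariants_eq_span_singleton hcard span_orbit
  have v_mem : v ∈ Representation.invariants (ρ.comp H.subtype) :=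
    hv ▸ Submodule.mem_span_singleton_self v
  have fv_mem : f v ∈ Representation.invariants (ρ.comp H.subtype) := fun h =>
    (f.map_smul (MonoidAlgebra.of K _ (h : Equiv.Perm α)) v).symm.trans (congrArg f (v_mem h))
  rw [hv, Submodule.mem_span_singleton] at fv_mem
  obtain ⟨c, hc⟩ := fv_mem
  refine ⟨c, LinearMap.ext_on (IsSimpleModule.span_singleton_eq_top _ hv0) fun u hu => ?_⟩
  rw [Set.mem_singleton_iff.1 hu, Module.algebraMap_end_apply, hc]

end ScalarEndomorphisms

section IsotypicCombination

variable {K A I : Type*} [CommRing K] [Ring A] [Algebra K A] {S : I → Type*}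
  [∀ i, AddCommGroup (S i)] [∀ i, Module K (S i)] [∀ i, Module A (S i)]
  [∀ i, IsScalarTower K A (S i)] {κ : I → Type*} [∀ i, Fintype (κ i)]

/-- The homomorphism from `∏ᵢ Sᵢ^{κᵢ}` to `Sᵢ` that sends `y` to the linear combination, with
coefficients `c`, of the coordinates of `y` in the copies of `Sᵢ`. -/
def isotypicCombination (A : Type*) [Ring A] [Algebra K A] [∀ i, Module A (S i)]
    [∀ i, IsScalarTower K A (S i)] (i : I) (c : κ i → K) : ((i : I) → κ i → S i) →ₗ[A] S i :=
  ∑ k, c k •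
    (LinearMap.proj (φ := fun _ => S i) k ∘ₗ LinearMap.proj (φ := fun i => κ i → S i) i)

theorem isotypicCombination_apply (i : I) (c : κ i → K) (y : (i : I) → κ i → S i) :
    isotypicCombination A i c y = ∑ k, c k • y i k := by
  simp [isotypicCombination]

theorem isotypicCombination_single_single [DecidableEq I] [∀ i, DecidableEq (κ i)] (i : I)
    (c : κ i → K) (k : κ i) (x : S i) :
    isotypicCombination A i c (Pi.single i (Pi.single k x)) = c k • x := by
  rw [isotypicCombination_apply, Pi.single_eq_same, Fintype.sum_eq_single k fun l hl => by
    rw [Pi.single_eq_of_ne hl, smul_zero], Pi.single_eq_same]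

theorem isotypicCombination_single_of_ne [DecidableEq I] {i j : I} (hij : j ≠ i) (c : κ i → K)
    (y : κ j → S j) : isotypicCombination A i c (Pi.single j y) = 0 := by
  simp [isotypicCombination_apply, Pi.single_eq_of_ne hij.symm]

end IsotypicCombination

section Decomposition

namespace IsCompleteSetOfSimples

variable {A : Type u} [Ring A] {t : ℕ} {S : Fin t → Type v} [∀ i, AddCommGroup (S i)]
  [∀ i, Module A (S i)]

theorem exists_linearEquiv (hS : IsCompleteSetOfSimples A S) (M : Type*) [AddCommGroup M]
    [Module A M] [IsSimpleModule A M] : ∃ i, Nonempty (M ≃ₗ[A] S i) := by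
  obtain ⟨J, _, ⟨e⟩⟩ := isSimpleModule_iff_quot_maximal.1 (inferInstance : IsSimpleModule A M)
  obtain ⟨i, ⟨e'⟩⟩ := hS.complete (A ⧸ J) (IsSimpleModule.congr e.symm)
  exact ⟨i, ⟨e.trans e'⟩⟩

theorem nonempty_index [Nontrivial A] (hS : IsCompleteSetOfSimples A S) : Nonempty (Fin t) := by
  obtain ⟨J, hJ⟩ := Ideal.exists_maximal A
  exact ⟨(hS.complete (A ⧸ J) (isSimpleModule_iff_isCoatom.2 hJ.out)).choose⟩

variable {K : Type*} [Field K] [Algebra K A] [∀ i, Module K (S i)] [∀ i, IsScalarTower K A (S i)]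
  {κ : Fin t → Type*}

theorem exists_eq_isotypicCombination [∀ i, Fintype (κ i)] (hS : IsCompleteSetOfSimples A S)
    {i : Fin t} (hend : Function.Surjective (algebraMap K (Module.End A (S i))))
    (ψ : ((i : Fin t) → κ i → S i) →ₗ[A] S i) :
    ∃ c : κ i → K, ψ = isotypicCombination A i c := by
  classical
  have := hS.simple
  choose c hc using fun k : κ i => hend
    (ψ ∘ₗ LinearMap.single A (fun i => κ i → S i) i ∘ₗ LinearMap.single A (fun _ => S i) k)
  refine ⟨c, LinearMap.pi_ext' fun j => LinearMap.pi_ext' fun k => ?_⟩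
  by_cases hij : j = i
  · subst hij
    ext x
    exact (LinearMap.congr_fun (hc k) x).symm.trans
      (isotypicCombination_single_single j c k x).symm
  · trans 0
    · refine (LinearMap.bijective_or_eq_zero _).resolve_left fun hbij => hij ?_
      exact hS.pairwise_not_iso _ _ ⟨LinearEquiv.ofBijective _ hbij⟩
    · ext x
      exact (isotypicCombination_single_of_ne hij c _).symm

theorem span_range_eq_top_iff_linearIndependent [∀ i, Finite (κ i)]
    (hS : IsCompleteSetOfSimples A S)
    (hend : ∀ i, Function.Surjective (algebraMap K (Module.End A (S i)))) {ι : Type*}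
    (f : ι → (i : Fin t) → κ i → S i) :
    Submodule.span A (Set.range f) = ⊤ ↔
      ∀ i, LinearIndependent K fun (k : κ i) (j : ι) => f j i k := by
  classical
  have (i : Fin t) := Fintype.ofFinite (κ i)
  have := hS.simple
  have nontrivial (i) := IsSimpleModule.nontrivial A (S i)
  have vanishes_iff (i) (c : κ i → K) : (∀ j, isotypicCombination A i c (f j) = 0) ↔
      ∑ k, c k • (fun j => f j i k) = 0 := by
    simp only [isotypicCombination_apply, funext_iff, Finset.sum_apply, Pi.smul_apply,
      Pi.zero_apply]
  simp only [Fintype.linearIndependent_iff, ← vanishes_iff]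
  constructor
  · intro hf i c hc k
    have eq_zero : isotypicCombination A i c = (0 : ((i : Fin t) → κ i → S i) →ₗ[A] S i) :=
      LinearMap.ext_on_range hf hc
    obtain ⟨x, hx⟩ := exists_ne (0 : S i)
    have := isotypicCombination_single_single (A := A) i c k x
    rw [eq_zero, LinearMap.zero_apply, eq_comm, smul_eq_zero] at this
    exact this.resolve_right hx
  · intro hind
    by_contra hne
    obtain ⟨N, hN, hle⟩ := (eq_top_or_exists_le_coatom _).resolve_left hne
    have := isSimpleModule_iff_isCoatom.2 hN
    obtain ⟨i, ⟨e⟩⟩ := hS.exists_linearEquiv (((i : Fin t) → κ i → S i) ⧸ N)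
    obtain ⟨c, hc⟩ := hS.exists_eq_isotypicCombination (hend i) (e.toLinearMap ∘ₗ N.mkQ)
    have hc0 : c = 0 := funext <| hind i c fun j => by
      rw [← hc, LinearMap.comp_apply, Submodule.mkQ_apply,
        (Submodule.Quotient.mk_eq_zero N).2 (hle (Submodule.subset_span ⟨j, rfl⟩)), map_zero]
    obtain ⟨x, hx⟩ := exists_ne (0 : S i)
    obtain ⟨y, rfl⟩ := (e.surjective.comp N.mkQ_surjective) x
    refine hx ((LinearMap.congr_fun hc y).trans ?_)
    simp [hc0, isotypicCombination_apply]

end IsCompleteSetOfSimples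

theorem isRGeneratedModule_congr {A M N : Type*} [Ring A] [AddCommGroup M] [Module A M]
    [AddCommGroup N] [Module A N] {r : ℕ} (e : M ≃ₗ[A] N) :
    IsRGeneratedModule A r M ↔ IsRGeneratedModule A r N := by
  refine (Equiv.arrowCongr (Equiv.refl (Fin r)) e.toEquiv).exists_congr fun f => ?_
  rw [← Submodule.map_eq_top_iff (e := e), Submodule.map_span, ← Set.range_comp]
  rfl

theorem exists_linearIndependent_iff_card_le_finrank {K M κ : Type*} [DivisionRing K]
    [AddCommGroup M] [Module K M] [Module.Finite K M] [Fintype κ] :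
    (∃ v : κ → M, LinearIndependent K v) ↔ Fintype.card κ ≤ Module.finrank K M := by
  refine ⟨fun ⟨_, hv⟩ => hv.fintype_card_le_finrank, fun h => ?_⟩
  obtain ⟨v, hv⟩ := exists_linearIndependent_of_le_finrank h
  exact ⟨v ∘ Fintype.equivFin κ, hv.comp _ (Fintype.equivFin κ).injective⟩

theorem IsCompleteSetOfSimples.isRGeneratedModule_iff {K : Type*} {A : Type u} [Field K] [Ring A]
    [Algebra K A] {t : ℕ} {S : Fin t → Type v} [∀ i, AddCommGroup (S i)] [∀ i, Module K (S i)]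
    [∀ i, Module A (S i)] [∀ i, IsScalarTower K A (S i)] [∀ i, Module.Finite K (S i)]
    (hS : IsCompleteSetOfSimples A S)
    (hend : ∀ i, Function.Surjective (algebraMap K (Module.End A (S i)))) {m : Fin t → ℕ}
    {V : Type*} [AddCommGroup V] [Module A V] (hV : HasDecomposition A S m V) (r : ℕ) :
    IsRGeneratedModule A r V ↔ ∀ i, m i ≤ r * Module.finrank K (S i) := by
  obtain ⟨e⟩ := hV
  have finrank_eq (i) : Module.finrank K (Fin r → S i) = r * Module.finrank K (S i) := by
    simp [Module.finrank_pi_fintype]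
  calc IsRGeneratedModule A r V
      ↔ ∃ f : Fin r → (i : Fin t) → Fin (m i) → S i,
          ∀ i, LinearIndependent K fun (k : Fin (m i)) (j : Fin r) => f j i k := by
        rw [isRGeneratedModule_congr e]
        exact exists_congr fun f => hS.span_range_eq_top_iff_linearIndependent hend f
    _ ↔ ∀ i, ∃ v : Fin (m i) → Fin r → S i, LinearIndependent K v :=
        ⟨fun ⟨f, hf⟩ i => ⟨_, hf i⟩, fun h =>
          ⟨fun j i k => (h i).choose k j, fun i => (h i).choose_spec⟩⟩
    _ ↔ ∀ i, m i ≤ r * Module.finrank K (S i) := by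
        simp only [exists_linearIndependent_iff_card_le_finrank, Fintype.card_fin, finrank_eq]

theorem exists_isGreatest_isLeast_natCeil {ι : Type*} [Finite ι] [Nonempty ι] {P : ℕ → Prop}
    {m d : ι → ℕ} (hd : ∀ i, 0 < d i) (hP : ∀ r, P r ↔ ∀ i, m i ≤ r * d i) :
    ∃ q : ℚ, IsGreatest (Set.range fun i => (m i : ℚ) / (d i : ℚ)) q ∧ IsLeast {r | P r} ⌈q⌉₊ := by
  obtain ⟨i₀, hi₀⟩ := Finite.exists_max fun i => (m i : ℚ) / (d i : ℚ)
  have le_mul_iff (r i) : m i ≤ r * d i ↔ (m i : ℚ) / (d i : ℚ) ≤ r := by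
    rw [div_le_iff₀ (by exact_mod_cast hd i)]
    exact_mod_cast Iff.rfl
  refine ⟨_, ⟨⟨i₀, rfl⟩, Set.forall_mem_range.2 hi₀⟩, ?_, fun r hr => ?_⟩
  · exact (hP _).2 fun i => (le_mul_iff _ i).2 ((hi₀ i).trans (Nat.le_ceil _))
  · exact Nat.ceil_le.2 ((le_mul_iff r i₀).1 ((hP r).1 hr i₀))

end Decomposition

section GeneratedRepresentations

variable {K G V : Type*} [CommRing K] [Group G] [AddCommGroup V] [Module K V]
  {ρ : Representation K G V}

theorem isRGeneratedModule_asModule_iff (ρ : Representation K G V) (r : ℕ) :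
    IsRGeneratedModule K[G] r ρ.asModule ↔
      ∃ f : Fin r → V, Submodule.span K {z | ∃ (σ : G) (j : Fin r), z = ρ σ (f j)} = ⊤ := by
  refine (Equiv.arrowCongr (Equiv.refl _) ρ.asModuleEquiv.toEquiv).exists_congr fun f => ?_
  rw [← Submodule.restrictScalars_eq_top_iff K, ← span_range_of_smul,
    ← Submodule.map_eq_top_iff (e := ρ.asModuleEquiv), Submodule.map_span]
  congr! 2
  have image_smul (σ : G) (x : ρ.asModule) :
      ρ.asModuleEquiv (MonoidAlgebra.of K G σ • x) = ρ σ (ρ.asModuleEquiv x) := by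
    rw [ρ.asModuleEquiv_map_smul, Representation.asAlgebraHom_of]
  ext z
  constructor
  · rintro ⟨_, ⟨σ, j, rfl⟩, rfl⟩
    exact ⟨σ, j, image_smul σ (f j)⟩
  · rintro ⟨σ, j, rfl⟩
    exact ⟨_, ⟨σ, j, rfl⟩, image_smul σ (f j)⟩

theorem isRGeneratedModule_subrepresentation_iff (W : Subrepresentation ρ) (r : ℕ) :
    IsRGeneratedModule K[G] r W.toRepresentation.asModule ↔
      ∃ f : Fin r → V,
        Submodule.span K {z | ∃ (σ : G) (j : Fin r), z = ρ σ (f j)} = W.toSubmodule := by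
  have map_span (f : Fin r → W.toSubmodule) :
      (Submodule.span K {z | ∃ (σ : G) (j : Fin r), z = W.toRepresentation σ (f j)}).map
          W.toSubmodule.subtype =
        Submodule.span K {z | ∃ (σ : G) (j : Fin r), z = ρ σ (f j)} := by
    rw [Submodule.map_span]
    congr 1
    ext z
    constructor
    · rintro ⟨_, ⟨σ, j, rfl⟩, rfl⟩
      exact ⟨σ, j, rfl⟩
    · rintro ⟨σ, j, rfl⟩
      exact ⟨_, ⟨σ, j, rfl⟩, rfl⟩
  have span_eq_iff (f : Fin r → W.toSubmodule) :
      Submodule.span K {z | ∃ (σ : G) (j : Fin r), z = W.toRepresentation σ (f j)} = ⊤ ↔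
        Submodule.span K {z | ∃ (σ : G) (j : Fin r), z = ρ σ (f j)} = W.toSubmodule := by
    rw [← map_span, ← (Submodule.map_injective_of_injective W.toSubmodule.injective_subtype).eq_iff,
      Submodule.map_top, Submodule.range_subtype]
  simp only [isRGeneratedModule_asModule_iff, span_eq_iff]
  refine ⟨fun ⟨f, hf⟩ => ⟨fun j => f j, hf⟩, fun ⟨f, hf⟩ => ⟨fun j => ⟨f j, ?_⟩, hf⟩⟩
  rw [← hf]
  exact Submodule.subset_span ⟨1, j, by simp⟩

end GeneratedRepresentations

section GeneratedInOneDegree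

open MvPolynomial

variable {τ R : Type*} [CommSemiring R] {X Y : Set (MvPolynomial τ R)} {d e : ℕ}

attribute [local instance] MvPolynomial.gradedAlgebra in
theorem homogeneousComponent_mul_of_isHomogeneous {s : MvPolynomial τ R} (hs : s.IsHomogeneous e)
    (k : ℕ) (p : MvPolynomial τ R) :
    homogeneousComponent k (p * s) = if e ≤ k then homogeneousComponent (k - e) p * s else 0 := by
  rw [← decomposition.decompose'_apply, ← decomposition.decompose'_apply]
  exact DirectSum.coe_decompose_mul_of_right_mem (homogeneousSubmodule τ R) k hs

theorem span_inf_homogeneousSubmodule_of_lt (hX : X ⊆ homogeneousSubmodule τ R e) (hd : d < e) :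
    (Ideal.span X).restrictScalars R ⊓ homogeneousSubmodule τ R d = ⊥ := by
  refine (Submodule.eq_bot_iff _).2 fun x ⟨hx, hxd⟩ => ?_
  obtain ⟨c, hc, rfl⟩ := Submodule.mem_span_set.1 hx
  rw [← homogeneousComponent_eq_self hxd, Finsupp.sum, map_sum]
  refine Finset.sum_eq_zero fun s hs => ?_
  rw [smul_eq_mul, homogeneousComponent_mul_of_isHomogeneous (hX (hc hs)), if_neg hd.not_ge]

theorem span_inf_homogeneousSubmodule_self (hX : X ⊆ homogeneousSubmodule τ R e) :
    (Ideal.span X).restrictScalars R ⊓ homogeneousSubmodule τ R e = Submodule.span R X := by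
  apply le_antisymm
  · rintro x ⟨hx, hxe⟩
    obtain ⟨c, hc, rfl⟩ := Submodule.mem_span_set.1 hx
    rw [← homogeneousComponent_eq_self hxe, Finsupp.sum, map_sum]
    refine Submodule.sum_mem _ fun s hs => ?_
    rw [smul_eq_mul, homogeneousComponent_mul_of_isHomogeneous (hX (hc hs)), if_pos le_rfl,
      Nat.sub_self, homogeneousComponent_zero, ← smul_eq_C_mul]
    exact Submodule.smul_mem _ _ (Submodule.subset_span (hc hs))
  · exact le_inf (Submodule.span_le_restrictScalars R (MvPolynomial τ R) X)
      (Submodule.span_le.2 hX)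

theorem degree_le_of_span_le_span (hX : X ⊆ homogeneousSubmodule τ R d)
    (hY : Y ⊆ homogeneousSubmodule τ R e) (hXY : Ideal.span X ≤ Ideal.span Y)
    (hne : Ideal.span X ≠ ⊥) : e ≤ d := by
  contrapose! hne
  rw [Ideal.span_eq_bot]
  intro x hx
  have x_mem := (Submodule.eq_bot_iff _).1 (span_inf_homogeneousSubmodule_of_lt hY hne) x
  exact x_mem ⟨hXY (Ideal.subset_span hx), hX hx⟩

end GeneratedInOneDegree

section SymmetricIdeals

open MvPolynomial

variable {K : Type*} [Field K] {n : ℕ}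

theorem orbit_subset_homogeneousSubmodule {r e : ℕ} {f : Fin r → MvPolynomial (Fin n) K}
    (hf : ∀ j, (f j).IsHomogeneous e) :
    {g | ∃ (σ : Equiv.Perm (Fin n)) (j : Fin r), g = permRep K n σ (f j)} ⊆
      (homogeneousSubmodule (Fin n) K e : Set (MvPolynomial (Fin n) K)) := by
  rintro _ ⟨σ, j, rfl⟩
  exact (hf j).rename_isHomogeneous

theorem isRGeneratedSymmetricIdeal_iff {d : ℕ} {I : Ideal (MvPolynomial (Fin n) K)}
    (hI : IsSymmetricIdeal I) (hd : IsGeneratedInDegree d I) (r : ℕ) :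
    IsRGeneratedSymmetricIdeal r I ↔
      IsRGeneratedModule K[Equiv.Perm (Fin n)] r
        (idealDegreePart I hI d).toRepresentation.asModule := by
  rw [isRGeneratedModule_subrepresentation_iff]
  constructor
  · rintro ⟨e, f, hf, rfl⟩
    refine ⟨f, ?_⟩
    have orbit_homogeneous := orbit_subset_homogeneousSubmodule hf
    by_cases h0 : symmetricIdealSpan f = ⊥
    · have part_eq_bot : (idealDegreePart (symmetricIdealSpan f) hI d).toSubmodule = ⊥ :=
        (Submodule.eq_bot_iff _).2 fun p hp =>
          (Submodule.eq_bot_iff _).1 h0 p hp.1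
      rw [part_eq_bot, Submodule.span_eq_bot]
      exact Ideal.span_eq_bot.1 h0
    · have hde : d = e := le_antisymm
        (degree_le_of_span_le_span orbit_homogeneous (fun s hs => hs.2) hd.le h0)
        (degree_le_of_span_le_span (fun s hs => hs.2) orbit_homogeneous hd.ge (hd ▸ h0))
      subst hde
      exact (span_inf_homogeneousSubmodule_self orbit_homogeneous).symm
  · rintro ⟨f, hf⟩
    have f_mem (j) : f j ∈ (idealDegreePart I hI d).toSubmodule :=
      hf ▸ Submodule.subset_span ⟨1, j, by simp⟩
    refine ⟨d, f, fun j => (f_mem j).2, ?_⟩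
    calc I = Ideal.span (idealDegreePart I hI d).toSubmodule := hd
      _ = symmetricIdealSpan f := by
        rw [← hf, Ideal.span, Submodule.span_span_of_tower]
        rfl

end SymmetricIdeals

theorem mainTheorem6 (K : Type u) [Field K] (n : ℕ)
    (hK : ringChar K = 0 ∨ n < ringChar K)
    (t : ℕ) (S : Fin t → Type v)
    [∀ i, AddCommGroup (S i)] [∀ i, Module K (S i)]
    [∀ i, Module (MonoidAlgebra K (Equiv.Perm (Fin n))) (S i)]
    [∀ i, IsScalarTower K (MonoidAlgebra K (Equiv.Perm (Fin n))) (S i)]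
    (hS : IsCompleteSetOfSimples (MonoidAlgebra K (Equiv.Perm (Fin n))) S) :
    -- finitely generated modules
    (∀ (V : Type w) [AddCommGroup V] [Module (MonoidAlgebra K (Equiv.Perm (Fin n))) V]
        [Module.Finite (MonoidAlgebra K (Equiv.Perm (Fin n))) V] (m : Fin t → ℕ),
      HasDecomposition (MonoidAlgebra K (Equiv.Perm (Fin n))) S m V →
      (∀ r : ℕ, IsRGeneratedModule (MonoidAlgebra K (Equiv.Perm (Fin n))) r V ↔
        ∀ i, m i ≤ r * Module.finrank K (S i)) ∧
      ∃ q : ℚ, IsGreatest (Set.range fun i => (m i : ℚ) / (Module.finrank K (S i) : ℚ)) q ∧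
        IsLeast {r : ℕ | IsRGeneratedModule (MonoidAlgebra K (Equiv.Perm (Fin n))) r V} ⌈q⌉₊) ∧
    -- symmetric ideals generated in a single degree
    (∀ (d : ℕ) (I : Ideal (MvPolynomial (Fin n) K)) (hI : IsSymmetricIdeal I),
      IsGeneratedInDegree d I → ∀ m : Fin t → ℕ,
      HasDecomposition (MonoidAlgebra K (Equiv.Perm (Fin n))) S m
        (idealDegreePart I hI d).toRepresentation.asModule →
      (∀ r : ℕ, IsRGeneratedSymmetricIdeal r I ↔ ∀ i, m i ≤ r * Module.finrank K (S i)) ∧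
      (∃ q : ℚ, IsGreatest (Set.range fun i => (m i : ℚ) / (Module.finrank K (S i) : ℚ)) q ∧
        IsLeast {r : ℕ | IsRGeneratedSymmetricIdeal r I} ⌈q⌉₊) ∧
      (IsPrincipalSymmetricIdeal I ↔ ∀ i, m i ≤ Module.finrank K (S i))) := by
  have hcard : (Nat.card (Equiv.Perm (Fin n)) : K) ≠ 0 := by
    rw [Nat.card_perm, Nat.card_fin]
    exact natCast_factorial_ne_zero_of_ringChar hK
  have := hS.simple
  have finite_simple (i) : Module.Finite K (S i) := Module.Finite.trans K[Equiv.Perm (Fin n)] (S i)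
  have nontrivial_simple (i) : Nontrivial (S i) :=
    IsSimpleModule.nontrivial K[Equiv.Perm (Fin n)] (S i)
  have := hS.nonempty_index
  have finrank_pos (i) : 0 < Module.finrank K (S i) := Module.finrank_pos
  have end_scalar (i) := surjective_algebraMap_end_of_isSimpleModule_perm hcard (S := S i)
  constructor
  · intro V _ _ _ m hV
    have generated_iff := hS.isRGeneratedModule_iff end_scalar hV
    exact ⟨generated_iff, exists_isGreatest_isLeast_natCeil finrank_pos generated_iff⟩
  · intro d I hI hd m hm
    have generated_iff (r) := (isRGeneratedSymmetricIdeal_iff hI hd r).trans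
      (hS.isRGeneratedModule_iff end_scalar hm r)
    exact ⟨generated_iff, exists_isGreatest_isLeast_natCeil finrank_pos generated_iff,
      by simpa only [IsPrincipalSymmetricIdeal, one_mul] using generated_iff 1⟩
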